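/- Let $a,b,\lambda,q\in\mathbb C$ with $0<|q|<1$, with $a,b,\lambda$ not all zero, and suppose that for every integer $n\ge 1$ $$\lambda\neq abq^n,\qquad \lambda\neq -\frac{b}{q^n},\qquad \lambda\neq-\frac{a}{q^{n-1}} .$$ Consider the four continued fractions $$F_1=1+\frac{aq+\lambda q}{1}{{}\atop{+}}\frac{bq+\lambda q^2}{1}{{}\atop{+}}\frac{aq^2+\lambda q^3}{1}{{}\atop{+}}\frac{bq^2+\lambda q^4}{1}{{}\atop{+\cdots}}$$ $$F_2=1+aq+\frac{\lambda q-abq^2}{1+bq+aq^2}{{}\atop{+}}\frac{\lambda q^2-abq^4}{1+bq^2+aq^3}{{}\atop{+}}\frac{\lambda q^3-abq^6}{1+bq^3+aq^4}{{}\atop{+\cdots}}$$ $$F_3=1-b+aq+\frac{\lambda q+b}{1-b+aq^2}{{}\atop{+}}\frac{\lambda q^2+b}{1-b+aq^3}{{}\atop{+}}\frac{\lambda q^3+b}{1-b+aq^4}{{}\atop{+\cdots}}$$ $$F_4=1+\frac{aq+\lambda q}{1-aq+bq}{{}\atop{+}}\frac{aq+\lambda q^2}{1-aq+bq^2}{{}\atop{+}}\frac{aq+\lambda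 q^3}{1-aq+bq^3}{{}\atop{+\cdots}}$$ All partial numerators are non-zero. A continued fraction converges to $L\in\hat{\mathbb C}=\mathbb C\cup\{\infty\}$ if its approximants $A_n/B_n$ ($A_n,B_n$ the numerator and denominator convergents) tend to $L$ in $\hat{\mathbb C}$. (i) There is an $L\in\hat{\mathbb C}$ such that $F_1$ and $F_2$ converge to $L$; if $|b|<1$ then $F_3$ converges to $L$; and if $|aq|<1$ then $F_4$ converges to $L$. In each case the numerators $A_n$ and the denominators $B_n$ converge separately in $\mathbb C$, to limits $A$, $B$ that are not both zero and satisfy $L=A/B$. (ii) If moreover $1+bq^n\neq 0$ for all $n\ge 1$, then $$L=\frac{G(a,b,\lambda)}{G(aq,b,\lambda q)}\ \text{ in }\hat{\mathbb C},\qquad G(a,b,\lambda)=\sum_{n\ge 0}\frac{q^{(n^2+n)/2}(a+\lambda)(a+\lambda q)\cdots(a+\lambda q^{n-1})}{(1-q)\cdots(1-q^n)(1+bq)\cdots(1+bq^n)},$$ where both series converge absolutely and their sums are not both zero. (iii) The Bauer–Muir transformation of $b_0+\frac{a_1}{b_1}{{}\atop{+}}\frac{a_2}{b_2}{{}\atop{+\cdots}}$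 with respect to $(w_n)_{n\ge0}$ exists if $\lambda_n:=a_n-w_{n-1}(b_n+w_n)\neq0$ for all $n\ge1$, and is then $$b_0+w_0+\frac{\lambda_1}{b_1+w_1}{{}\atop{+}}\frac{a_1\lambda_2/\lambda_1}{b_2+w_2-w_0\lambda_2/\lambda_1}{{}\atop{+}}\frac{a_2\lambda_3/\lambda_2}{b_3+w_3-w_1\lambda_3/\lambda_2}{{}\atop{+\cdots}}.$$ Given sequences $w^{(k)}=(w^{(k)}_n)_{n\ge 0}$, $k\ge0$, transform a continued fraction repeatedly, the $k$-th step ($k=0,1,2,\dots$) replacing the part of the current continued fraction that starts with the partial denominator $b_k$ by its Bauer–Muir transformation with respect to $w^{(k)}$. Then each of $F_1\to F_2$, $F_2\to F_3$, $F_3\to F_4$, $F_4\to F_1$ arises in this way from infinitely many steps: every transformation exists, and after the first $k$ steps the partial denominators $b_0,\dots,b_{k-1}$ and partial numerators $a_1,\dots,a_k$ are those of the target. The sequences are - $F_1\to F_2$: $w^{(k)}_{2n}=aq^{n+1+k}$, $w^{(k)}_{2n+1}=bq^{n+1+k}$; - $F_2\to F_3$: $w^{(k)}_n=-bq^n$;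 - $F_3\to F_4$: $w^{(k)}_n=bq^k-aq^{n+1}$; - $F_4\to F_1$: $w^{(2i)}_n=0$, $w^{(2i+1)}_n=aq^{i+1}-bq^{n+i+1}$. -/

import Mathlib

open Filter Topology

noncomputable section

namespace RRCF

/-- The quotient `x / y` in the Riemann sphere `ℂ ∪ {∞}`, for `(x, y) ≠ (0, 0)`. -/
def ratio (x y : ℂ) : OnePoint ℂ :=
  open Classical in if y = 0 then OnePoint.infty else ((x / y : ℂ) : OnePoint ℂ)

/-- An infinite continued fraction
`den 0 + num 0 / (den 1 + num 1 / (den 2 + num 2 / (den 3 + ⋯)))`.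
In the classical notation `b₀ + K (aₙ / bₙ)`, `den n` is `bₙ` and `num n` is `aₙ₊₁`. -/
structure CFrac where
  den : ℕ → ℂ
  num : ℕ → ℂ

/-- The same continued fraction as an object of Mathlib. -/
def CFrac.toGen (c : CFrac) : GenContFract ℂ :=
  ⟨c.den 0, Stream'.Seq.ofStream fun n => ⟨c.num n, c.den (n + 1)⟩⟩

/-- The `n`-th numerator convergent `Aₙ`. -/
def CFrac.numer (c : CFrac) (n : ℕ) : ℂ := c.toGen.nums n

/-- The `n`-th denominator convergent `Bₙ`. -/
def CFrac.denom (c : CFrac) (n : ℕ) : ℂ := c.toGen.dens n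

/-- The `n`-th approximant `Aₙ / Bₙ`, in the Riemann sphere. (If no partial numerator vanishes,
then `Aₙ` and `Bₙ` are never both zero.) -/
def CFrac.approximant (c : CFrac) (n : ℕ) : OnePoint ℂ := ratio (c.numer n) (c.denom n)

/-- The continued fraction has non-zero partial numerators and converges to `L` in the
Riemann sphere. -/
def CFrac.ConvergesTo (c : CFrac) (L : OnePoint ℂ) : Prop :=
  (∀ n, c.num n ≠ 0) ∧ Tendsto c.approximant atTop (𝓝 L)

/-- The numerator and denominator convergents converge separately in `ℂ`, to limits that are not
both zero and have quotient `L`. -/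
def CFrac.ConvergesSeparatelyTo (c : CFrac) (L : OnePoint ℂ) : Prop :=
  ∃ A B : ℂ, Tendsto c.numer atTop (𝓝 A) ∧ Tendsto c.denom atTop (𝓝 B) ∧
    (A ≠ 0 ∨ B ≠ 0) ∧ L = ratio A B

/-- `bmLambda c w n` is `λₙ₊₁ = aₙ₊₁ - wₙ (bₙ₊₁ + wₙ₊₁)`. -/
def bmLambda (c : CFrac) (w : ℕ → ℂ) (n : ℕ) : ℂ :=
  c.num n - w n * (c.den (n + 1) + w (n + 1))

/-- The partial denominators of the Bauer–Muir transformation. -/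
def bmDen (c : CFrac) (w : ℕ → ℂ) : ℕ → ℂ
  | 0 => c.den 0 + w 0
  | 1 => c.den 1 + w 1
  | n + 2 => c.den (n + 2) + w (n + 2) - w n * (bmLambda c w (n + 1) / bmLambda c w n)

/-- The partial numerators of the Bauer–Muir transformation. -/
def bmNum (c : CFrac) (w : ℕ → ℂ) : ℕ → ℂ
  | 0 => bmLambda c w 0
  | n + 1 => c.num n * (bmLambda c w (n + 1) / bmLambda c w n)

/-- The Bauer–Muir transformation of `c` with respect to `w`,
`b₀ + w₀ + λ₁ / (b₁ + w₁ + (a₁ λ₂ / λ₁) / (b₂ + w₂ - w₀ λ₂ / λ₁ + ⋯))`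
(meaningful if no `λₙ` vanishes). -/
def bauerMuir (c : CFrac) (w : ℕ → ℂ) : CFrac := ⟨bmDen c w, bmNum c w⟩

/-- The part of `c` that starts at the partial denominator `den k`. -/
def CFrac.tail (c : CFrac) (k : ℕ) : CFrac := ⟨fun n => c.den (k + n), fun n => c.num (k + n)⟩

/-- Replace the part of `c` that starts at the partial denominator `den k` by `d`. -/
def CFrac.replaceTail (c : CFrac) (k : ℕ) (d : CFrac) : CFrac :=
  ⟨fun n => if n < k then c.den n else d.den (n - k),
   fun n => if n < k then c.num n else d.num (n - k)⟩

/-- Repeated Bauer–Muir transformation: step `k` transforms the part that starts at `den k`, with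
respect to the sequence `w k`. -/
def bmIterate (c : CFrac) (w : ℕ → ℕ → ℂ) : ℕ → CFrac
  | 0 => c
  | k + 1 => (bmIterate c w k).replaceTail k (bauerMuir ((bmIterate c w k).tail k) (w k))

/-- `d` is obtained from `c` by the infinitely many successive Bauer–Muir transformations with
respect to `w 0, w 1, …`: every one of them exists, and after the first `k` of them
the partial denominators and numerators with index below `k` are those of `d`. -/
def BauerMuirObtains (c : CFrac) (w : ℕ → ℕ → ℂ) (d : CFrac) : Prop :=
  (∀ k n, bmLambda ((bmIterate c w k).tail k) (w k) n ≠ 0) ∧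
  ∀ k n, n < k → (bmIterate c w k).den n = d.den n ∧ (bmIterate c w k).num n = d.num n

/-- `1 + (aq + lq)/1 + (bq + lq²)/1 + (aq² + lq³)/1 + (bq² + lq⁴)/1 + ⋯` -/
def cf1 (a b l q : ℂ) : CFrac :=
  ⟨fun _ => 1, fun n => (if Even n then a else b) * q ^ (n / 2 + 1) + l * q ^ (n + 1)⟩

/-- `1 + aq + (lq - abq²)/(1 + bq + aq²) + (lq² - abq⁴)/(1 + bq² + aq³) + ⋯` -/
def cf2 (a b l q : ℂ) : CFrac :=
  ⟨fun n => if n = 0 then 1 + a * q else 1 + b * q ^ n + a * q ^ (n + 1),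
   fun n => l * q ^ (n + 1) - a * b * q ^ (2 * (n + 1))⟩

/-- `1 - b + aq + (lq + b)/(1 - b + aq²) + (lq² + b)/(1 - b + aq³) + ⋯` -/
def cf3 (a b l q : ℂ) : CFrac :=
  ⟨fun n => 1 - b + a * q ^ (n + 1), fun n => l * q ^ (n + 1) + b⟩

/-- `1 + (aq + lq)/(1 - aq + bq) + (aq + lq²)/(1 - aq + bq²) + ⋯` -/
def cf4 (a b l q : ℂ) : CFrac :=
  ⟨fun n => if n = 0 then 1 else 1 - a * q + b * q ^ n, fun n => a * q + l * q ^ (n + 1)⟩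

/-- Modifying sequences from `cf1` to `cf2`. -/
def w12 (a b q : ℂ) (k n : ℕ) : ℂ := (if Even n then a else b) * q ^ (n / 2 + 1 + k)

/-- Modifying sequences from `cf2` to `cf3`. -/
def w23 (b q : ℂ) (_k n : ℕ) : ℂ := -b * q ^ n

/-- Modifying sequences from `cf3` to `cf4`. -/
def w34 (a b q : ℂ) (k n : ℕ) : ℂ := b * q ^ k - a * q ^ (n + 1)

/-- Modifying sequences from `cf4` to `cf1`. -/
def w41 (a b q : ℂ) (k n : ℕ) : ℂ :=
  if Even k then 0 else a * q ^ (k / 2 + 1) - b * q ^ (n + k / 2 + 1)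

/-- The general term of the series `G(a, b, l)`. -/
def gTerm (a b l q : ℂ) (n : ℕ) : ℂ :=
  q ^ ((n ^ 2 + n) / 2) * (∏ k ∈ Finset.range n, (a + l * q ^ k)) /
    ∏ k ∈ Finset.range n, ((1 - q ^ (k + 1)) * (1 + b * q ^ (k + 1)))

/-- `G(a, b, l) = ∑ q^((n²+n)/2) (a+l)⋯(a+lq^(n-1)) / ((1-q)⋯(1-q^n) (1+bq)⋯(1+bq^n))`. -/
def G (a b l q : ℂ) : ℂ := ∑' n, gTerm a b l q n

end RRCF

end

noncomputable section

namespace RRCF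

/-! Write E(x) for the entire function (1+xq)(1+xq²)⋯ and H(a,b,λ) for G(a,b,λ) times E(b), expanded
so that no division by 1+bqⁿ remains; H is defined for all parameters. All four fractions converge
to H(a,b,λ)/H(aq,b,λq).

Comparing terms gives contiguous relations for H. For each fraction they yield a sequence T of
values of H with T 0 = H(a,b,λ), T 1 = H(aq,b,λq) and Tₙ = bₙTₙ₊₁ + aₙ₊₁Tₙ₊₂, the adjoint of the
recurrence for the convergents. For any solution X of that recurrence, Tₙ₊₂Xₙ₊₁ + aₙ₊₂Tₙ₊₃Xₙ does
not depend on n. If T has a non-zero limit and aₙ → β with |β| < 1, this is a first-order recurrence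
for X with multiplier tending to -β, so X converges (`CFrac.tendsto_of_adjoint`). The limit of T is
1 for F₁ and F₂, E(b) for F₃ and E(aq) for F₄; the bounds on b and aq give both |β| < 1 and a
non-zero limit.

The Bauer–Muir claims are independent of this: the tail left after k steps has an explicit form, and
it is preserved because, except in trivial steps, consecutive λₙ have ratio q. -/

/-! ### Limits of linear recurrences and of quotients on the sphere -/

lemma tendsto_zero_of_affine_bound {y e : ℕ → ℝ} {r : ℝ} (hr0 : 0 ≤ r) (hr : r < 1)
    (hy0 : ∀ n, 0 ≤ y n) (he : Tendsto e atTop (𝓝 0))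
    (hy : ∀ᶠ n in atTop, y (n + 1) ≤ r * y n + e n) : Tendsto y atTop (𝓝 0) := by
  have h1r : 0 < 1 - r := by linarith
  rw [Metric.tendsto_atTop]
  intro ε hε
  have he' : ∀ᶠ n in atTop, e n < ε / 2 * (1 - r) := he.eventually_lt_const (by positivity)
  obtain ⟨N, hN⟩ := eventually_atTop.1 (hy.and he')
  have key : ∀ m, y (N + m) ≤ r ^ m * y N + ε / 2 := by
    intro m
    induction m with
    | zero => simp; linarith
    | succ m ih =>
      obtain ⟨h1, h2⟩ := hN (N + m) (by omega)
      have h3 := mul_le_mul_of_nonneg_left ih hr0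
      rw [← add_assoc]
      calc y (N + m + 1) ≤ r * y (N + m) + e (N + m) := h1
        _ ≤ r * (r ^ m * y N + ε / 2) + ε / 2 * (1 - r) := by linarith
        _ = _ := by ring
  have hp : Tendsto (fun m => r ^ m * y N) atTop (𝓝 0) := by
    simpa using (tendsto_pow_atTop_nhds_zero_of_lt_one hr0 hr).mul_const (y N)
  obtain ⟨K, hK⟩ := eventually_atTop.1 (hp.eventually_lt_const (half_pos hε))
  refine ⟨N + K, fun n hn => ?_⟩
  obtain ⟨m, rfl⟩ := Nat.exists_eq_add_of_le (show N ≤ n by omega)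
  have := key m
  have := hK m (by omega)
  rw [Real.dist_eq, sub_zero, abs_of_nonneg (hy0 _)]
  linarith

/-- A first-order linear recurrence whose coefficients converge, the multiplier to a limit inside
the unit disc, has convergent solutions. -/
lemma tendsto_of_linear_recurrence {X u v : ℕ → ℂ} {x u' v' : ℂ} (hu : Tendsto u atTop (𝓝 u'))
    (hv : Tendsto v atTop (𝓝 v')) (hv' : ‖v'‖ < 1) (hx : x = u' + v' * x)
    (hX : ∀ᶠ n in atTop, X (n + 1) = u n + v n * X n) : Tendsto X atTop (𝓝 x) := by
  obtain ⟨r, hr1, hr2⟩ := exists_between hv'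
  rw [tendsto_iff_norm_sub_tendsto_zero]
  have he : Tendsto (fun n => ‖u n + v n * x - x‖) atTop (𝓝 0) := by
    have := ((hu.add (hv.mul_const x)).sub_const x).norm
    rwa [← hx, sub_self, norm_zero] at this
  refine tendsto_zero_of_affine_bound ((norm_nonneg _).trans hr1.le) hr2 (fun _ => norm_nonneg _)
    he ?_
  filter_upwards [hX, hv.norm.eventually_lt_const hr1] with n h1 h2
  calc ‖X (n + 1) - x‖ = ‖v n * (X n - x) + (u n + v n * x - x)‖ := by rw [h1]; ring_nf
    _ ≤ ‖v n‖ * ‖X n - x‖ + ‖u n + v n * x - x‖ := (norm_add_le _ _).trans (by rw [norm_mul])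
    _ ≤ _ := by gcongr

lemma tendsto_ratio {A B : ℕ → ℂ} {A' B' : ℂ} (hA : Tendsto A atTop (𝓝 A'))
    (hB : Tendsto B atTop (𝓝 B')) (h : A' ≠ 0 ∨ B' ≠ 0) :
    Tendsto (fun n => ratio (A n) (B n)) atTop (𝓝 (ratio A' B')) := by
  by_cases hB' : B' = 0
  · have hA' : A' ≠ 0 := h.resolve_right (not_not.2 hB')
    subst hB'
    rw [show ratio A' 0 = OnePoint.infty by simp [ratio]]
    refine OnePoint.le_nhds_infty.2 fun s _ hs => ?_
    obtain ⟨R, hR⟩ := hs.isBounded.exists_norm_le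
    -- A compact set lies in a disc of radius R, and this inequality puts Aₙ/Bₙ outside that disc.
    have h1 : ∀ᶠ n in atTop, R * ‖B n‖ < ‖A n‖ := by
      have h2 : Tendsto (fun n => R * ‖B n‖) atTop (𝓝 0) := by simpa using hB.norm.const_mul R
      exact h2.eventually_lt hA.norm (norm_pos_iff.2 hA')
    rw [Filter.mem_map]
    filter_upwards [h1] with n hn
    by_cases hBn : B n = 0
    · simp [ratio, hBn]
    · refine Or.inl ⟨A n / B n, fun hmem => ?_, by simp [ratio, hBn]⟩
      have h3 := hR _ hmem
      rw [norm_div, div_le_iff₀ (norm_pos_iff.2 hBn)] at h3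
      linarith
  · rw [show ratio A' B' = ((A' / B' : ℂ) : OnePoint ℂ) by simp [ratio, hB']]
    have h1 : Tendsto (fun n => ((A n / B n : ℂ) : OnePoint ℂ)) atTop
        (𝓝 ((A' / B' : ℂ) : OnePoint ℂ)) :=
      (OnePoint.continuous_coe.tendsto _).comp (hA.div hB hB')
    refine h1.congr' ?_
    filter_upwards [hB.eventually_ne hB'] with n hn
    simp [ratio, hn]

lemma ratio_mul_left {x y z : ℂ} (hz : z ≠ 0) : ratio (z * x) (z * y) = ratio x y := by
  by_cases hy : y = 0
  · simp [ratio, hy]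
  · simp [ratio, hy, hz, mul_div_mul_left]

/-! ### Convergents and the adjoint recurrence -/

namespace CFrac

lemma toGen_get (c : CFrac) (n : ℕ) : c.toGen.s.get? n = some ⟨c.num n, c.den (n + 1)⟩ := rfl

lemma numer_zero (c : CFrac) : c.numer 0 = c.den 0 := GenContFract.zeroth_num_eq_h

lemma denom_zero (c : CFrac) : c.denom 0 = 1 := GenContFract.zeroth_den_eq_one

lemma numer_one (c : CFrac) : c.numer 1 = c.den 1 * c.den 0 + c.num 0 :=
  GenContFract.first_num_eq (c.toGen_get 0)

lemma denom_one (c : CFrac) : c.denom 1 = c.den 1 := GenContFract.first_den_eq (c.toGen_get 0)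

lemma numer_add_two (c : CFrac) (n : ℕ) :
    c.numer (n + 2) = c.den (n + 2) * c.numer (n + 1) + c.num (n + 1) * c.numer n :=
  GenContFract.nums_recurrence (c.toGen_get (n + 1)) rfl rfl

lemma denom_add_two (c : CFrac) (n : ℕ) :
    c.denom (n + 2) = c.den (n + 2) * c.denom (n + 1) + c.num (n + 1) * c.denom n :=
  GenContFract.dens_recurrence (c.toGen_get (n + 1)) rfl rfl

/-- Solutions of the three-term recurrence converge if its adjoint recurrence has a solution with
non-zero limit. -/
lemma tendsto_of_adjoint {c : CFrac} {T X : ℕ → ℂ} {β τ : ℂ}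
    (hT : ∀ n, T n = c.den n * T (n + 1) + c.num n * T (n + 2)) (hτ : Tendsto T atTop (𝓝 τ))
    (hτ0 : τ ≠ 0) (hβ : Tendsto c.num atTop (𝓝 β)) (hβ1 : ‖β‖ < 1)
    (hX : ∀ n, X (n + 2) = c.den (n + 2) * X (n + 1) + c.num (n + 1) * X n) :
    Tendsto X atTop (𝓝 ((τ * (1 + β))⁻¹ * (T 2 * X 1 + c.num 1 * T 3 * X 0))) := by
  set W := T 2 * X 1 + c.num 1 * T 3 * X 0 with hW
  -- A discrete Wronskian: a step of the recurrence for X is cancelled by the adjoint step for T.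
  have hinv : ∀ n, T (n + 2) * X (n + 1) + c.num (n + 1) * T (n + 3) * X n = W := by
    intro n
    induction n with
    | zero => rfl
    | succ n ih =>
      rw [← ih, hX n, hT (n + 2)]
      ring
  have hβ0 : 1 + β ≠ 0 := by
    intro h
    rw [show β = -1 by linear_combination h] at hβ1
    simp at hβ1
  have hT2 : Tendsto (fun n => T (n + 2)) atTop (𝓝 τ) := (tendsto_add_atTop_iff_nat 2).2 hτ
  have hT3 : Tendsto (fun n => T (n + 3)) atTop (𝓝 τ) := (tendsto_add_atTop_iff_nat 3).2 hτ
  have hβ' : Tendsto (fun n => c.num (n + 1)) atTop (𝓝 β) := (tendsto_add_atTop_iff_nat 1).2 hβ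
  refine tendsto_of_linear_recurrence (u := fun n => W / T (n + 2))
    (v := fun n => -(c.num (n + 1) * T (n + 3)) / T (n + 2)) (tendsto_const_nhds.div hT2 hτ0)
    ((hβ'.mul hT3).neg.div hT2 hτ0) (by simpa [hτ0] using hβ1) (by field_simp; ring) ?_
  filter_upwards [hT2.eventually_ne hτ0] with n hn
  rw [← hinv n]
  field_simp
  ring

/-- A continued fraction converges to `T 0 / T 1` if `T` solves the adjoint recurrence and has
a non-zero limit. -/
lemma converges_of_adjoint {c : CFrac} {T : ℕ → ℂ} {β τ : ℂ} (hc : ∀ n, c.num n ≠ 0)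
    (hT : ∀ n, T n = c.den n * T (n + 1) + c.num n * T (n + 2)) (hτ : Tendsto T atTop (𝓝 τ))
    (hτ0 : τ ≠ 0) (hβ : Tendsto c.num atTop (𝓝 β)) (hβ1 : ‖β‖ < 1) :
    (c.ConvergesTo (ratio (T 0) (T 1)) ∧ c.ConvergesSeparatelyTo (ratio (T 0) (T 1))) ∧
      (T 0 ≠ 0 ∨ T 1 ≠ 0) := by
  have hβ0 : 1 + β ≠ 0 := by
    intro h
    rw [show β = -1 by linear_combination h] at hβ1
    simp at hβ1
  have hs : (τ * (1 + β))⁻¹ ≠ 0 := inv_ne_zero (mul_ne_zero hτ0 hβ0)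
  have hA := tendsto_of_adjoint hT hτ hτ0 hβ hβ1 c.numer_add_two
  have hB := tendsto_of_adjoint hT hτ hτ0 hβ hβ1 c.denom_add_two
  -- Unwinding the adjoint recurrence down to index 0, the invariant is T 0 for the numerators and T
  -- 1 for the denominators.
  rw [numer_zero, numer_one, show T 2 * (c.den 1 * c.den 0 + c.num 0) + c.num 1 * T 3 * c.den 0 =
    T 0 by rw [hT 0, hT 1]; ring] at hA
  rw [denom_zero, denom_one, show T 2 * c.den 1 + c.num 1 * T 3 * 1 =
    T 1 by rw [hT 1]; ring] at hB
  have hT01 : T 0 ≠ 0 ∨ T 1 ≠ 0 := by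
    -- Two consecutive zeros propagate forward because the partial numerators are non-zero, so T
    -- would vanish identically.
    by_contra! h
    have h0 : ∀ n, T n = 0 ∧ T (n + 1) = 0 := by
      intro n
      induction n with
      | zero => exact h
      | succ n ih =>
        refine ⟨ih.2, ?_⟩
        have := hT n
        rw [ih.1, ih.2, mul_zero, zero_add] at this
        exact (mul_eq_zero.1 this.symm).resolve_left (hc n)
    rw [show T = fun _ => 0 from funext fun n => (h0 n).1] at hτ
    exact hτ0 (tendsto_nhds_unique hτ tendsto_const_nhds)
  have hAB : (τ * (1 + β))⁻¹ * T 0 ≠ 0 ∨ (τ * (1 + β))⁻¹ * T 1 ≠ 0 :=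
    hT01.imp (mul_ne_zero hs) (mul_ne_zero hs)
  refine ⟨⟨⟨hc, ?_⟩, _, _, hA, hB, hAB, (ratio_mul_left hs).symm⟩, hT01⟩
  have := tendsto_ratio hA hB hAB
  rwa [ratio_mul_left hs] at this

end CFrac

/-! ### Repeated Bauer–Muir transformations -/

/-- A step alters only the current tail, so it suffices to guess the tail `C k` met by step k: its
transform must begin with the k-th terms of the target and continue as `C (k + 1)`. -/
lemma bauerMuirObtains_of_tails {c d : CFrac} {w : ℕ → ℕ → ℂ} (C : ℕ → CFrac) (h0 : C 0 = c)
    (hl : ∀ k n, bmLambda (C k) (w k) n ≠ 0)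
    (hden : ∀ k, bmDen (C k) (w k) 0 = d.den k) (hnum : ∀ k, bmNum (C k) (w k) 0 = d.num k)
    (hden' : ∀ k n, bmDen (C k) (w k) (n + 1) = (C (k + 1)).den n)
    (hnum' : ∀ k n, bmNum (C k) (w k) (n + 1) = (C (k + 1)).num n) :
    BauerMuirObtains c w d := by
  have htail : ∀ k, (bmIterate c w k).tail k = C k := by
    intro k
    induction k with
    | zero => simp [bmIterate, CFrac.tail, h0]
    | succ k ih =>
      have h1 : ∀ n, ¬ k + 1 + n < k := fun n => by omega
      have h2 : ∀ n, k + 1 + n - k = n + 1 := fun n => by omega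
      rw [bmIterate, ih]
      simp [CFrac.replaceTail, CFrac.tail, bauerMuir, h1, h2, hden', hnum']
  refine ⟨fun k n => by rw [htail]; exact hl k n, fun k => ?_⟩
  induction k with
  | zero => intro n hn; omega
  | succ k ih =>
    intro n hn
    rcases Nat.lt_succ_iff_lt_or_eq.1 hn with h | rfl
    · simpa [bmIterate, CFrac.replaceTail, h] using ih n h
    · simp [bmIterate, CFrac.replaceTail, htail, bauerMuir, hden, hnum]

lemma bauerMuirObtains_cf1_cf2 {a b l q : ℂ} (hq : q ≠ 0)
    (h : ∀ n : ℕ, l ≠ a * b * q ^ (n + 1)) :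
    BauerMuirObtains (cf1 a b l q) (w12 a b q) (cf2 a b l q) := by
  -- The initial 1 + bqᵏ arises because the transformed denominator of index 1 has no correction
  -- term; at later indices wₙ₊₂ - q wₙ = 0 restores the 1.
  set C : ℕ → CFrac := fun k =>
    ⟨fun n => if n = 0 ∧ k ≠ 0 then 1 + b * q ^ k else 1, fun n => q ^ k * (cf1 a b l q).num n⟩
  have hlam : ∀ k n, bmLambda (C k) (w12 a b q k) n =
      q ^ n * (q ^ (k + 1) * (l - a * b * q ^ (k + 1))) := by
    intro k n
    rcases n.even_or_odd' with ⟨m, rfl | rfl⟩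
    · have h1 : (2 * m + 1) / 2 = m := by omega
      simp [bmLambda, C, cf1, w12, h1]
      ring
    · have h1 : (2 * m + 1) / 2 = m := by omega
      have h2 : (2 * m + 1 + 1) / 2 = m + 1 := by omega
      simp [bmLambda, C, cf1, w12, h1, h2, Nat.even_add_one]
      ring
  have hne : ∀ k n, bmLambda (C k) (w12 a b q k) n ≠ 0 := fun k n => by
    rw [hlam]
    exact mul_ne_zero (pow_ne_zero _ hq) (mul_ne_zero (pow_ne_zero _ hq) (sub_ne_zero.2 (h k)))
  have hdiv : ∀ k n, bmLambda (C k) (w12 a b q k) (n + 1) / bmLambda (C k) (w12 a b q k) n = q := by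
    intro k n
    rw [div_eq_iff (hne k n), hlam, hlam]
    ring
  refine bauerMuirObtains_of_tails C ?_ hne ?_ ?_ ?_ ?_
  · simp [C, cf1]
  · intro k
    rcases k with _ | k
    · simp [bmDen, C, cf2, w12]
    · simp [bmDen, C, cf2, w12]
      exact Or.inl (by ring)
  · intro k
    simp only [bmNum, hlam, cf2]
    ring
  · intro k n
    rcases n with _ | n
    · simp [bmDen, C, w12]
      exact Or.inl (by ring)
    · have h1 : (n + 2) / 2 = n / 2 + 1 := by omega
      simp only [bmDen, hdiv]
      simp [C, w12, h1, Nat.even_add_one]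
      ring_nf
  · intro k n
    simp only [bmNum, hdiv, C]
    ring

lemma bauerMuirObtains_cf2_cf3 {a b l q : ℂ} (hq : q ≠ 0)
    (h : ∀ n : ℕ, l * q ^ (n + 1) + b ≠ 0) :
    BauerMuirObtains (cf2 a b l q) (w23 b q) (cf3 a b l q) := by
  -- The tail is again of the type of F₂, with a and λ multiplied by qᵏ; hence the modifying
  -- sequence need not depend on k.
  set C : ℕ → CFrac := fun k => cf2 (a * q ^ k) b (l * q ^ k) q
  have hlam : ∀ k n, bmLambda (C k) (w23 b q k) n = q ^ n * (l * q ^ (k + 1) + b) := by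
    intro k n
    simp [bmLambda, C, cf2, w23]
    ring
  have hne : ∀ k n, bmLambda (C k) (w23 b q k) n ≠ 0 := fun k n => by
    rw [hlam]
    exact mul_ne_zero (pow_ne_zero _ hq) (h k)
  have hdiv : ∀ k n, bmLambda (C k) (w23 b q k) (n + 1) / bmLambda (C k) (w23 b q k) n = q := by
    intro k n
    rw [div_eq_iff (hne k n), hlam, hlam]
    ring
  refine bauerMuirObtains_of_tails C ?_ hne ?_ ?_ ?_ ?_
  · simp [C]
  · intro k
    simp [bmDen, C, cf2, cf3, w23]
    ring
  · intro k
    simp only [bmNum, hlam, cf3]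
    ring
  · intro k n
    rcases n with _ | n
    · simp [bmDen, C, cf2, w23]
      ring
    · simp only [bmDen, hdiv]
      simp [C, cf2, w23]
      ring
  · intro k n
    simp only [bmNum, hdiv]
    simp only [C, cf2]
    ring

lemma bauerMuirObtains_cf3_cf4 {a b l q : ℂ} (hq : q ≠ 0) (h : ∀ n : ℕ, a + l * q ^ n ≠ 0) :
    BauerMuirObtains (cf3 a b l q) (w34 a b q) (cf4 a b l q) := by
  set C : ℕ → CFrac := fun k =>
    ⟨fun n => if n = 0 ∧ k ≠ 0 then 1 else 1 - b * q ^ k + a * q ^ (n + 1),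
      (cf3 a (b * q ^ k) (l * q ^ k) q).num⟩
  have hlam : ∀ k n, bmLambda (C k) (w34 a b q k) n = q ^ n * (q * (a + l * q ^ k)) := by
    intro k n
    simp [bmLambda, C, cf3, w34]
    ring
  have hne : ∀ k n, bmLambda (C k) (w34 a b q k) n ≠ 0 := fun k n => by
    rw [hlam]
    exact mul_ne_zero (pow_ne_zero _ hq) (mul_ne_zero hq (h k))
  have hdiv : ∀ k n, bmLambda (C k) (w34 a b q k) (n + 1) / bmLambda (C k) (w34 a b q k) n = q := by
    intro k n
    rw [div_eq_iff (hne k n), hlam, hlam]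
    ring
  refine bauerMuirObtains_of_tails C ?_ hne ?_ ?_ ?_ ?_
  · simp [C, cf3]
  · intro k
    rcases k with _ | k
    · simp [bmDen, C, cf4, w34]
    · simp [bmDen, C, cf4, w34]
      ring
  · intro k
    simp only [bmNum, hlam, cf4]
    ring
  · intro k n
    rcases n with _ | n
    · simp [bmDen, C, w34]
    · simp only [bmDen, hdiv]
      simp [C, w34]
      ring
  · intro k n
    simp only [bmNum, hdiv]
    simp only [C, cf3]
    ring

lemma bauerMuirObtains_cf4_cf1 {a b l q : ℂ} (hq : q ≠ 0) (ha : ∀ n : ℕ, a + l * q ^ n ≠ 0)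
    (hb : ∀ n : ℕ, b + l * q ^ (n + 1) ≠ 0) :
    BauerMuirObtains (cf4 a b l q) (w41 a b q) (cf1 a b l q) := by
  -- Steps come in pairs. An even step has w = 0, hence is the identity and merely moves past one
  -- term; an odd step has consecutive λₙ in ratio q.
  set C : ℕ → CFrac := fun k => ⟨fun n => if n = 0 ∧ Even k then 1 else
      1 - a * q ^ (k / 2 + 1) + b * q ^ (n + (k + 1) / 2),
    fun n => q ^ (k / 2 + 1) * (a + l * q ^ (n + (k + 1) / 2))⟩
  have hw0 : ∀ i n, w41 a b q (2 * i) n = 0 := by simp [w41]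
  have hw1 : ∀ i n, w41 a b q (2 * i + 1) n = a * q ^ (i + 1) - b * q ^ (n + i + 1) := by
    intro i n
    have h1 : (2 * i + 1) / 2 = i := by omega
    simp [w41, h1]
  have h1 : ∀ i : ℕ, 2 * i / 2 = i := fun i => by omega
  have h2 : ∀ i : ℕ, (2 * i + 1) / 2 = i := fun i => by omega
  have h3 : ∀ i : ℕ, (2 * i + 1 + 1) / 2 = i + 1 := fun i => by omega
  have h4 : ∀ i : ℕ, (2 * i + 1 + 1 + 1) / 2 = i + 1 := fun i => by omega
  have hlam0 : ∀ i n, bmLambda (C (2 * i)) (w41 a b q (2 * i)) n = (C (2 * i)).num n := by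
    intro i n
    simp [bmLambda, hw0]
  have hnum0 : ∀ i n, (C (2 * i)).num n ≠ 0 := fun i n =>
    mul_ne_zero (pow_ne_zero _ hq) (ha _)
  have hlam1 : ∀ i n, bmLambda (C (2 * i + 1)) (w41 a b q (2 * i + 1)) n =
      q ^ n * (q ^ (i + 1) * (b + l * q ^ (i + 1))) := by
    intro i n
    simp [bmLambda, hw1, C, h2, h3]
    ring
  have hne1 : ∀ i n, bmLambda (C (2 * i + 1)) (w41 a b q (2 * i + 1)) n ≠ 0 := fun i n => by
    rw [hlam1]
    exact mul_ne_zero (pow_ne_zero _ hq) (mul_ne_zero (pow_ne_zero _ hq) (hb i))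
  have hdiv1 : ∀ i n, bmLambda (C (2 * i + 1)) (w41 a b q (2 * i + 1)) (n + 1) /
      bmLambda (C (2 * i + 1)) (w41 a b q (2 * i + 1)) n = q := by
    intro i n
    rw [div_eq_iff (hne1 i n), hlam1, hlam1]
    ring
  refine bauerMuirObtains_of_tails C ?_ ?_ ?_ ?_ ?_ ?_
  · simp only [C, cf4, CFrac.mk.injEq]
    refine ⟨funext fun n => ?_, funext fun n => ?_⟩
    · simp
    · simp
      ring
  · intro k n
    rcases k.even_or_odd' with ⟨i, rfl | rfl⟩
    · rw [hlam0]; exact hnum0 i n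
    · exact hne1 i n
  · intro k
    rcases k.even_or_odd' with ⟨i, rfl | rfl⟩
    · simp [bmDen, hw0, C, cf1]
    · simp [bmDen, hw1, C, cf1, h2, h3]
  · intro k
    rcases k.even_or_odd' with ⟨i, rfl | rfl⟩
    · rw [bmNum, hlam0]
      simp [C, cf1, h1, h2]
      ring
    · simp [bmNum, hlam1, cf1, h2]
      ring
  · intro k n
    rcases k.even_or_odd' with ⟨i, rfl | rfl⟩
    · rcases n with _ | n
      · simp [bmDen, hw0, C, h1, h2, h3]
        exact Or.inl (by ring)
      · simp [bmDen, hw0, C, h1, h2, h3]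
        exact Or.inl (by ring)
    · rcases n with _ | n
      · simp [bmDen, hw1, C, h2, h3, Nat.even_add_one]
        ring
      · simp only [bmDen, hw1, hdiv1]
        simp [C, h2, h3, h4, Nat.even_add_one]
        ring
  · intro k n
    rcases k.even_or_odd' with ⟨i, rfl | rfl⟩
    · rw [bmNum, hlam0, hlam0, mul_div_cancel₀ _ (hnum0 i n)]
      simp [C, h1, h2, h3]
      exact Or.inl (Or.inl (by ring))
    · simp only [bmNum, hdiv1]
      simp [C, h2, h3, h4]
      ring

/-! ### Euler's series and the entire form of G -/

/-- Euler's coefficients `q^((n²+n)/2) / ((1-q)⋯(1-q^n))`. -/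
def eulerCoeff (q : ℂ) (n : ℕ) : ℂ :=
  q ^ ((n ^ 2 + n) / 2) / ∏ k ∈ Finset.range n, (1 - q ^ (k + 1))

/-- The power series `∑ q^((n²+n)/2) xⁿ / ((1-q)⋯(1-q^n))`, which is `(1+xq)(1+xq²)⋯`. -/
def eulerSum (q x : ℂ) : ℂ := ∑' n, eulerCoeff q n * x ^ n

/-- The factor `(a+l)(a+lq)⋯(a+lq^(n-1))`. -/
def shiftedPow (a l q : ℂ) (n : ℕ) : ℂ := ∏ k ∈ Finset.range n, (a + l * q ^ k)

/-- The general term of `entireG`. -/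
def entireGTerm (a b l q : ℂ) (n : ℕ) : ℂ :=
  eulerCoeff q n * shiftedPow a l q n * eulerSum q (b * q ^ n)

/-- The series `G(a, b, l)` multiplied by `(1+bq)(1+bq²)⋯`. -/
def entireG (a b l q : ℂ) : ℂ := ∑' n, entireGTerm a b l q n

variable {q : ℂ}

lemma one_sub_pow_ne_zero (hq : ‖q‖ < 1) (n : ℕ) : 1 - q ^ (n + 1) ≠ 0 := by
  intro h
  have h1 : ‖q ^ (n + 1)‖ = 1 := by rw [← sub_eq_zero.1 h, norm_one]
  rw [norm_pow] at h1
  exact (pow_lt_one₀ (norm_nonneg _) hq n.succ_ne_zero).ne h1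

lemma eulerCoeff_succ (hq : ‖q‖ < 1) (n : ℕ) :
    eulerCoeff q (n + 1) * (1 - q ^ (n + 1)) = q ^ (n + 1) * eulerCoeff q n := by
  have h1 : ((n + 1) ^ 2 + (n + 1)) / 2 = (n ^ 2 + n) / 2 + (n + 1) := by
    rw [show (n + 1) ^ 2 + (n + 1) = n ^ 2 + n + (n + 1) * 2 by ring,
      Nat.add_mul_div_right _ _ two_pos]
  have h2 := one_sub_pow_ne_zero hq n
  rw [eulerCoeff, eulerCoeff, Finset.prod_range_succ, h1, pow_add, ← div_div,
    div_mul_cancel₀ _ h2]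
  ring

/-- The ratio of consecutive terms tends to 0 whatever R is. This series is the majorant in every
dominated convergence argument below. -/
lemma summable_norm_eulerCoeff_mul_pow (hq : ‖q‖ < 1) (R : ℝ) :
    Summable fun n => ‖eulerCoeff q n‖ * R ^ n := by
  refine summable_of_ratio_norm_eventually_le (r := 1 / 2) (by norm_num) ?_
  have hp : Tendsto (fun n : ℕ => q ^ (n + 1)) atTop (𝓝 0) :=
    (tendsto_add_atTop_iff_nat 1).2 (tendsto_pow_atTop_nhds_zero_of_norm_lt_one hq)
  have h1 : Tendsto (fun n : ℕ => ‖q ^ (n + 1) / (1 - q ^ (n + 1))‖ * |R|) atTop (𝓝 0) := by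
    have := ((hp.div (hp.const_sub 1) (by simp)).norm).mul_const |R|
    simpa using this
  filter_upwards [h1.eventually_lt_const (show (0 : ℝ) < 1 / 2 by norm_num)] with n hn
  have h2 : eulerCoeff q (n + 1) = q ^ (n + 1) / (1 - q ^ (n + 1)) * eulerCoeff q n := by
    rw [div_mul_eq_mul_div, eq_div_iff (one_sub_pow_ne_zero hq n), eulerCoeff_succ hq]
  rw [h2, norm_mul, norm_mul, norm_mul, norm_mul, norm_norm, norm_norm, norm_pow, norm_pow,
    Real.norm_eq_abs]
  calc ‖q ^ (n + 1) / (1 - q ^ (n + 1))‖ * ‖eulerCoeff q n‖ * |R| ^ (n + 1)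
      = (‖q ^ (n + 1) / (1 - q ^ (n + 1))‖ * |R|) * (‖eulerCoeff q n‖ * |R| ^ n) := by ring
    _ ≤ _ := by gcongr

lemma norm_mul_pow_le (hq : ‖q‖ < 1) (x : ℂ) (n : ℕ) : ‖x * q ^ n‖ ≤ ‖x‖ := by
  rw [norm_mul, norm_pow]
  exact mul_le_of_le_one_right (norm_nonneg _) (pow_le_one₀ (norm_nonneg _) hq.le)

lemma norm_shiftedPow_le (hq : ‖q‖ < 1) {a l : ℂ} {R : ℝ} (h : ‖a‖ + ‖l‖ ≤ R) (n : ℕ) :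
    ‖shiftedPow a l q n‖ ≤ R ^ n := by
  rw [shiftedPow, norm_prod]
  refine (Finset.prod_le_prod (fun _ _ => norm_nonneg _) fun k _ => ?_).trans_eq
    (by rw [Finset.prod_const, Finset.card_range])
  exact (norm_add_le _ _).trans ((add_le_add_right (norm_mul_pow_le hq l k) _).trans h)

lemma norm_eulerSum_le (hq : ‖q‖ < 1) {x : ℂ} {R : ℝ} (h : ‖x‖ ≤ R) :
    ‖eulerSum q x‖ ≤ ∑' n, ‖eulerCoeff q n‖ * R ^ n := by
  refine tsum_of_norm_bounded (summable_norm_eulerCoeff_mul_pow hq R).hasSum fun n => ?_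
  rw [norm_mul, norm_pow]
  gcongr

lemma summable_eulerSum (hq : ‖q‖ < 1) (x : ℂ) : Summable fun n => eulerCoeff q n * x ^ n :=
  Summable.of_norm (by simpa using summable_norm_eulerCoeff_mul_pow hq ‖x‖)

lemma norm_entireGTerm_le (hq : ‖q‖ < 1) {a b l : ℂ} {R S : ℝ} (h : ‖a‖ + ‖l‖ ≤ R)
    (hb : ‖b‖ ≤ S) (n : ℕ) :
    ‖entireGTerm a b l q n‖ ≤
      ‖eulerCoeff q n‖ * R ^ n * ∑' n, ‖eulerCoeff q n‖ * S ^ n := by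
  rw [entireGTerm, norm_mul, norm_mul]
  have hR : 0 ≤ R := (add_nonneg (norm_nonneg a) (norm_nonneg l)).trans h
  gcongr
  · exact norm_shiftedPow_le hq h n
  · exact norm_eulerSum_le hq ((norm_mul_pow_le hq b n).trans hb)

lemma summable_entireGTerm (hq : ‖q‖ < 1) (a b l : ℂ) : Summable (entireGTerm a b l q) :=
  Summable.of_norm_bounded ((summable_norm_eulerCoeff_mul_pow hq (‖a‖ + ‖l‖)).mul_right _)
    (norm_entireGTerm_le hq le_rfl le_rfl)

lemma tendsto_eulerSum (hq : ‖q‖ < 1) {x : ℕ → ℂ} {x' : ℂ} (hx : Tendsto x atTop (𝓝 x')) :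
    Tendsto (fun m => eulerSum q (x m)) atTop (𝓝 (eulerSum q x')) := by
  refine tendsto_tsum_of_dominated_convergence
    (summable_norm_eulerCoeff_mul_pow hq (‖x'‖ + 1)) (fun n => (hx.pow n).const_mul _) ?_
  filter_upwards [hx.norm.eventually_le_const (lt_add_one _)] with m hm n
  rw [norm_mul, norm_pow]
  gcongr

/-- Dominated convergence, with bounds slightly larger than the limiting parameters. It supplies the
limits of the adjoint solutions. -/
lemma tendsto_entireG (hq : ‖q‖ < 1) {a b l : ℕ → ℂ} {a' b' l' : ℂ}
    (ha : Tendsto a atTop (𝓝 a')) (hb : Tendsto b atTop (𝓝 b')) (hl : Tendsto l atTop (𝓝 l')) :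
    Tendsto (fun m => entireG (a m) (b m) (l m) q) atTop (𝓝 (entireG a' b' l' q)) := by
  refine tendsto_tsum_of_dominated_convergence
    ((summable_norm_eulerCoeff_mul_pow hq (‖a'‖ + ‖l'‖ + 1)).mul_right
      (∑' n, ‖eulerCoeff q n‖ * (‖b'‖ + 1) ^ n)) (fun n => ?_) ?_
  · refine Tendsto.mul (Tendsto.const_mul _ ?_) (tendsto_eulerSum hq (hb.mul_const _))
    exact tendsto_finsetProd _ fun k _ => ha.add (hl.mul_const _)
  · filter_upwards [(ha.norm.add hl.norm).eventually_le_const (lt_add_one _),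
      hb.norm.eventually_le_const (lt_add_one _)] with m h1 h2 n
    exact norm_entireGTerm_le hq h1 h2 n

lemma eulerSum_zero : eulerSum q 0 = 1 := by
  rw [eulerSum, tsum_eq_single 0 (fun n hn => by simp [hn])]
  simp [eulerCoeff]

lemma eulerSum_eq_mul (hq : ‖q‖ < 1) (x : ℂ) :
    eulerSum q x = (1 + x * q) * eulerSum q (x * q) := by
  have h1 := summable_eulerSum hq x
  have h2 := summable_eulerSum hq (x * q)
  have h3 : eulerSum q x - eulerSum q (x * q) = x * q * eulerSum q (x * q) := by
    rw [eulerSum, eulerSum, ← h1.tsum_sub h2, (h1.sub h2).tsum_eq_zero_add, ← tsum_mul_left]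
    simp only [pow_zero, sub_self, zero_add]
    refine tsum_congr fun n => ?_
    linear_combination x ^ (n + 1) * eulerCoeff_succ hq n
  linear_combination h3

lemma eulerSum_eq_prod_mul (hq : ‖q‖ < 1) (x : ℂ) (n : ℕ) :
    eulerSum q x = (∏ k ∈ Finset.range n, (1 + x * q ^ (k + 1))) * eulerSum q (x * q ^ n) := by
  induction n with
  | zero => simp
  | succ n ih =>
    rw [ih, eulerSum_eq_mul hq (x * q ^ n), Finset.prod_range_succ]
    ring_nf

lemma tendsto_mul_pow (hq : ‖q‖ < 1) (x : ℂ) : Tendsto (fun n => x * q ^ n) atTop (𝓝 0) := by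
  simpa using (tendsto_pow_atTop_nhds_zero_of_norm_lt_one hq).const_mul x

/-- A zero at x would propagate to every xqⁿ through the functional equation, against E(xqⁿ) → E(0)
= 1. -/
lemma eulerSum_ne_zero (hq : ‖q‖ < 1) {x : ℂ} (hx : ∀ n, 1 + x * q ^ (n + 1) ≠ 0) :
    eulerSum q x ≠ 0 := by
  intro h
  have h1 : ∀ n, eulerSum q (x * q ^ n) = 0 := by
    intro n
    have := eulerSum_eq_prod_mul hq x n
    rw [h] at this
    exact (mul_eq_zero.1 this.symm).resolve_left (Finset.prod_ne_zero_iff.2 fun k _ => hx k)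
  have h2 := tendsto_eulerSum hq (tendsto_mul_pow hq x)
  simp [h1, eulerSum_zero] at h2

lemma eulerSum_ne_zero_of_norm_lt_one (hq : ‖q‖ < 1) {x : ℂ} (hx : ‖x‖ < 1) :
    eulerSum q x ≠ 0 := by
  refine eulerSum_ne_zero hq fun n h => ?_
  have h1 : ‖x * q ^ (n + 1)‖ = 1 := by
    rw [show x * q ^ (n + 1) = -1 by linear_combination h]
    simp
  exact ((norm_mul_pow_le hq x _).trans_lt hx).ne h1

lemma entireG_zero_right (a : ℂ) : entireG a 0 0 q = eulerSum q a := by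
  simp [entireG, entireGTerm, shiftedPow, eulerSum_zero]
  rfl

lemma entireG_zero_outer (b : ℂ) : entireG 0 b 0 q = eulerSum q b := by
  rw [entireG, tsum_eq_single 0 (fun n hn => by simp [entireGTerm, shiftedPow, hn])]
  simp [entireGTerm, shiftedPow, eulerCoeff]

/-! ### Contiguous relations -/

lemma shiftedPow_succ (a l : ℂ) (n : ℕ) :
    shiftedPow a l q (n + 1) = (a + l) * shiftedPow a (l * q) q n := by
  rw [shiftedPow, Finset.prod_range_succ', shiftedPow, mul_comm]
  simp only [pow_zero, mul_one]
  congr 1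
  exact Finset.prod_congr rfl fun k _ => by ring

lemma shiftedPow_succ' (a l : ℂ) (n : ℕ) :
    shiftedPow a l q (n + 1) = shiftedPow a l q n * (a + l * q ^ n) :=
  Finset.prod_range_succ _ _

lemma shiftedPow_mul (a l x : ℂ) (n : ℕ) :
    shiftedPow (a * x) (l * x) q n = x ^ n * shiftedPow a l q n := by
  rw [shiftedPow, shiftedPow, ← Finset.card_range n, ← Finset.prod_const, Finset.card_range,
    ← Finset.prod_mul_distrib]
  exact Finset.prod_congr rfl fun k _ => by ring

lemma shiftedPow_mul_q (a l : ℂ) (n : ℕ) :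
    shiftedPow (a * q) (l * q ^ 2) q n = q ^ n * shiftedPow a (l * q) q n := by
  rw [← shiftedPow_mul]
  ring_nf

/-- Contiguous relation that shifts `a` and `l`. -/
lemma entireG_shift_al (hq : ‖q‖ < 1) (a b l : ℂ) : entireG a b l q =
    entireG (a * q) b (l * q) q + (a * q + l * q) * entireG (a * q) (b * q) (l * q ^ 2) q := by
  have h1 := summable_entireGTerm hq a b l
  have h2 := summable_entireGTerm hq (a * q) b (l * q)
  rw [← sub_eq_iff_eq_add', entireG, entireG, ← h1.tsum_sub h2, (h1.sub h2).tsum_eq_zero_add,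
    entireG, ← tsum_mul_left]
  -- Scaling a and λ by q multiplies the n-th term by qⁿ. The difference thus carries 1 - qⁿ, which
  -- the recursion for Euler's coefficients absorbs while lowering the index by one.
  simp only [entireGTerm, shiftedPow_mul_q, shiftedPow_mul, pow_zero, one_mul, sub_self, zero_add]
  refine tsum_congr fun n => ?_
  rw [shiftedPow_succ, show b * q * q ^ n = b * q ^ (n + 1) by ring]
  linear_combination (a + l) * shiftedPow a (l * q) q n * eulerSum q (b * q ^ (n + 1)) *
    eulerCoeff_succ hq n

/-- Contiguous relation that shifts `b`. -/
lemma entireG_shift_b (hq : ‖q‖ < 1) (a b l : ℂ) : entireG a b l q =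
    entireG a (b * q) l q + b * q * entireG (a * q) (b * q) (l * q) q := by
  have h1 := summable_entireGTerm hq a (b * q) l
  have h2 := (summable_entireGTerm hq (a * q) (b * q) (l * q)).mul_left (b * q)
  rw [entireG, entireG, entireG, ← tsum_mul_left, ← h1.tsum_add h2]
  refine tsum_congr fun n => ?_
  simp only [entireGTerm, shiftedPow_mul]
  rw [eulerSum_eq_mul hq (b * q ^ n), show b * q * q ^ n = b * q ^ n * q by ring]
  ring

/-- Contiguous relation that shifts `l`. -/
lemma entireG_shift_l (hq : ‖q‖ < 1) (a b l : ℂ) : entireG a b l q =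
    entireG a b (l * q) q + l * q * entireG (a * q) (b * q) (l * q ^ 2) q := by
  have h1 := summable_entireGTerm hq a b l
  have h2 := summable_entireGTerm hq a b (l * q)
  rw [← sub_eq_iff_eq_add', entireG, entireG, ← h1.tsum_sub h2, (h1.sub h2).tsum_eq_zero_add,
    entireG, ← tsum_mul_left]
  simp only [entireGTerm, shiftedPow_mul_q]
  rw [show shiftedPow a l q 0 = shiftedPow a (l * q) q 0 from rfl, sub_self, zero_add]
  refine tsum_congr fun n => ?_
  -- The two products share n factors and differ by the factor λ(1 - qⁿ⁺¹), to which the coefficient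
  -- recursion applies again.
  rw [shiftedPow_succ, shiftedPow_succ', show b * q * q ^ n = b * q ^ (n + 1) by ring]
  linear_combination l * shiftedPow a (l * q) q n * eulerSum q (b * q ^ (n + 1)) *
    eulerCoeff_succ hq n

/-- Contiguous relation that shifts `b` and `l`. -/
lemma entireG_shift_bl (hq : ‖q‖ < 1) (a b l : ℂ) : entireG a b l q =
    entireG a (b * q) (l * q) q + (b * q + l * q) * entireG (a * q) (b * q) (l * q ^ 2) q := by
  have h1 := entireG_shift_l hq a b l
  have h2 := entireG_shift_b hq a b (l * q)
  rw [show l * q * q = l * q ^ 2 by ring] at h2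
  linear_combination h1 + h2

/-- Contiguous relation that shifts `a`. -/
lemma entireG_shift_a (hq : ‖q‖ < 1) (a b l : ℂ) : entireG a b l q =
    entireG (a * q) b l q + a * q * entireG (a * q) (b * q) (l * q) q := by
  -- The defect of the claimed relation after n shifts of the parameters. The relations already
  -- known give D n = λq²ⁿ⁺¹ D (n+1), and D tends to 0.
  set D : ℕ → ℂ := fun n => entireG (a * q ^ n) (b * q ^ n) (l * q ^ (2 * n)) q -
    entireG (a * q ^ n * q) (b * q ^ n) (l * q ^ (2 * n)) q -
    a * q ^ n * q * entireG (a * q ^ n * q) (b * q ^ n * q) (l * q ^ (2 * n) * q) q with hD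
  have hrec : ∀ n, D n = l * q ^ (2 * n) * q * D (n + 1) := by
    intro n
    have h1 := entireG_shift_al hq (a * q ^ n) (b * q ^ n) (l * q ^ (2 * n))
    have h2 := entireG_shift_l hq (a * q ^ n * q) (b * q ^ n) (l * q ^ (2 * n))
    have h3 := entireG_shift_l hq (a * q ^ n * q) (b * q ^ n * q) (l * q ^ (2 * n) * q)
    simp only [hD]
    ring_nf at h1 h2 h3 ⊢
    linear_combination h1 - h2 - a * q * q ^ n * h3
  have hlim : Tendsto D atTop (𝓝 0) := by
    have ha := tendsto_mul_pow hq a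
    have hb := tendsto_mul_pow hq b
    have hl : Tendsto (fun n => l * q ^ (2 * n)) atTop (𝓝 0) :=
      (tendsto_mul_pow hq l).comp (tendsto_id.const_mul_atTop' two_pos)
    have h0 := tendsto_entireG hq ha hb hl
    have h1 := tendsto_entireG hq (ha.mul_const q) hb hl
    have h2 := tendsto_entireG hq (ha.mul_const q) (hb.mul_const q) (hl.mul_const q)
    have h3 := (h0.sub h1).sub ((ha.mul_const q).mul h2)
    simpa using h3
  have hprod : ∀ n, D 0 = (∏ k ∈ Finset.range n, (l * q ^ (2 * k) * q)) * D n := by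
    intro n
    induction n with
    | zero => simp
    | succ n ih => rw [ih, hrec n, Finset.prod_range_succ]; ring
  have hD0 : D 0 = 0 := by
    have hl : Tendsto (fun n => ‖l * q ^ (2 * n) * q‖) atTop (𝓝 0) := by
      simpa using (((tendsto_mul_pow hq l).comp
        (tendsto_id.const_mul_atTop' two_pos)).mul_const q).norm
    obtain ⟨N, hN⟩ := eventually_atTop.1 (hl.eventually_le_const one_pos)
    -- Once the multipliers have modulus at most 1, |D| is non-decreasing with limit 0, so it
    -- vanishes there; the product formula carries this back to D 0.
    have hmono : Monotone fun m => ‖D (m + N)‖ := by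
      refine monotone_nat_of_le_succ fun m => ?_
      rw [hrec (m + N), norm_mul, show m + 1 + N = m + N + 1 by ring]
      exact mul_le_of_le_one_left (norm_nonneg _) (hN _ (by omega))
    have h1 := hmono.ge_of_tendsto
      (by simpa using ((tendsto_add_atTop_iff_nat N).2 hlim).norm) 0
    rw [hprod N, show D N = 0 by simpa using h1, mul_zero]
  simp only [hD, pow_zero, mul_one, mul_zero] at hD0
  linear_combination hD0

/-! ### Three-term relations behind F₂, F₃ and F₄ -/

lemma entireG_shift_a_al (hq : ‖q‖ < 1) (a b l : ℂ) : entireG a b l q =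
    (1 + a * q) * entireG (a * q) b (l * q) q +
      (l * q - a * b * q ^ 2) * entireG (a * q ^ 2) (b * q) (l * q ^ 2) q := by
  have h1 := entireG_shift_al hq a b l
  have h2 := entireG_shift_b hq (a * q) b (l * q)
  have h3 := entireG_shift_l hq (a * q) (b * q) (l * q)
  have h4 := entireG_shift_a hq (a * q) (b * q) (l * q ^ 2)
  ring_nf at h1 h2 h3 h4 ⊢
  linear_combination h1 - a * q * h2 - a * q * h3 + l * q * h4

lemma entireG_shift_abl (hq : ‖q‖ < 1) (a b l : ℂ) : entireG a b l q =
    (1 + b * q + a * q) * entireG (a * q) (b * q) (l * q) q +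
      (l * q - a * b * q ^ 3) * entireG (a * q ^ 2) (b * q ^ 2) (l * q ^ 2) q := by
  have h1 := entireG_shift_b hq a b l
  have h2 := entireG_shift_a_al hq a (b * q) l
  ring_nf at h1 h2 ⊢
  linear_combination h1 + h2

lemma entireG_shift_al_al (hq : ‖q‖ < 1) (a b l : ℂ) : entireG a b l q =
    (1 - b + a * q) * entireG (a * q) b (l * q) q +
      (l * q + b) * entireG (a * q ^ 2) b (l * q ^ 2) q := by
  have h1 := entireG_shift_al hq a b l
  have h2 := entireG_shift_al hq (a * q) b (l * q)
  have h3 := entireG_shift_bl hq (a * q) b (l * q)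
  ring_nf at h1 h2 h3 ⊢
  linear_combination h1 - (a * q + l * q) * h3 + (l * q + b) * h2

lemma entireG_shift_bl_bl (hq : ‖q‖ < 1) (a b l : ℂ) : entireG a b l q =
    (1 - a + b * q) * entireG a (b * q) (l * q) q +
      (l * q + a) * entireG a (b * q ^ 2) (l * q ^ 2) q := by
  have h1 := entireG_shift_bl hq a b l
  have h2 := entireG_shift_bl hq a (b * q) (l * q)
  have h3 := entireG_shift_al hq a (b * q) (l * q)
  ring_nf at h1 h2 h3 ⊢
  linear_combination h1 - (b * q + l * q) * h3 + (l * q + a) * h2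

/-! ### Convergence of the four continued fractions -/

lemma entireG_zero : entireG 0 0 0 q = 1 := by
  rw [entireG_zero_right, eulerSum_zero]

lemma tendsto_half : Tendsto (fun n : ℕ => n / 2) atTop atTop :=
  Nat.tendsto_div_const_atTop two_ne_zero

lemma converges_cf1 (hq : ‖q‖ < 1) {a b l : ℂ} (hc : ∀ n, (cf1 a b l q).num n ≠ 0) :
    ((cf1 a b l q).ConvergesTo (ratio (entireG a b l q) (entireG (a * q) b (l * q) q)) ∧
      (cf1 a b l q).ConvergesSeparatelyTo
        (ratio (entireG a b l q) (entireG (a * q) b (l * q) q))) ∧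
    (entireG a b l q ≠ 0 ∨ entireG (a * q) b (l * q) q ≠ 0) := by
  -- Shifts of (a, λ) and of (b, λ) alternate, matching the two kinds of partial numerator in F₁.
  set T : ℕ → ℂ := fun n =>
    entireG (a * q ^ ((n + 1) / 2)) (b * q ^ (n / 2)) (l * q ^ n) q with hTdef
  have hT0 : T 0 = entireG a b l q := by simp [T]
  have hT1 : T 1 = entireG (a * q) b (l * q) q := by simp [T]
  have hT : ∀ n, T n = (cf1 a b l q).den n * T (n + 1) + (cf1 a b l q).num n * T (n + 2) := by
    intro n
    rcases n.even_or_odd' with ⟨m, rfl | rfl⟩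
    · have e1 : (2 * m + 1) / 2 = m := by omega
      have e2 : (2 * m + 1 + 1) / 2 = m + 1 := by omega
      have e4 : (2 * m + 2 + 1) / 2 = m + 1 := by omega
      have h := entireG_shift_al hq (a * q ^ m) (b * q ^ m) (l * q ^ (2 * m))
      simp [T, cf1, e1, e2, e4]
      ring_nf at h ⊢
      linear_combination h
    · have e1 : (2 * m + 1) / 2 = m := by omega
      have e2 : (2 * m + 1 + 1) / 2 = m + 1 := by omega
      have e3 : (2 * m + 1 + 2) / 2 = m + 1 := by omega
      have e4 : (2 * m + 1 + 2 + 1) / 2 = m + 2 := by omega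
      have h := entireG_shift_bl hq (a * q ^ (m + 1)) (b * q ^ m) (l * q ^ (2 * m + 1))
      simp [T, cf1, e1, e2, e3, e4]
      ring_nf at h ⊢
      linear_combination h
  have hτ : Tendsto T atTop (𝓝 1) := by
    rw [← entireG_zero (q := q)]
    refine tendsto_entireG hq ?_ ((tendsto_mul_pow hq b).comp tendsto_half) (tendsto_mul_pow hq l)
    exact (tendsto_mul_pow hq a).comp (tendsto_half.comp (tendsto_add_atTop_nat 1))
  have hβ : Tendsto (cf1 a b l q).num atTop (𝓝 0) := by
    have h1 : ∀ x : ℂ, Tendsto (fun n : ℕ => x * q ^ (n / 2 + 1)) atTop (𝓝 0) := fun x =>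
      (tendsto_mul_pow hq x).comp ((tendsto_add_atTop_nat 1).comp tendsto_half)
    have h2 : Tendsto (fun n : ℕ => (if Even n then a else b) * q ^ (n / 2 + 1)) atTop (𝓝 0) := by
      simp only [ite_mul]
      exact (h1 a).if' (h1 b)
    simpa [cf1] using h2.add ((tendsto_mul_pow hq l).comp (tendsto_add_atTop_nat 1))
  rw [← hT0, ← hT1]
  exact CFrac.converges_of_adjoint hc hT hτ one_ne_zero hβ (by simp)

lemma converges_cf2 (hq : ‖q‖ < 1) {a b l : ℂ} (hc : ∀ n, (cf2 a b l q).num n ≠ 0) :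
    (cf2 a b l q).ConvergesTo (ratio (entireG a b l q) (entireG (a * q) b (l * q) q)) ∧
      (cf2 a b l q).ConvergesSeparatelyTo
        (ratio (entireG a b l q) (entireG (a * q) b (l * q) q)) := by
  -- Truncated subtraction leaves b unshifted at both n = 0 and n = 1; hence the first relation
  -- differs from the later ones.
  set T : ℕ → ℂ := fun n => entireG (a * q ^ n) (b * q ^ (n - 1)) (l * q ^ n) q with hTdef
  have hT0 : T 0 = entireG a b l q := by simp [T]
  have hT1 : T 1 = entireG (a * q) b (l * q) q := by simp [T]
  have hT : ∀ n, T n = (cf2 a b l q).den n * T (n + 1) + (cf2 a b l q).num n * T (n + 2) := by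
    intro n
    rcases n with _ | n
    · simpa [T, cf2] using entireG_shift_a_al hq a b l
    · have h := entireG_shift_abl hq (a * q ^ (n + 1)) (b * q ^ n) (l * q ^ (n + 1))
      simp [T, cf2]
      ring_nf at h ⊢
      linear_combination h
  have hτ : Tendsto T atTop (𝓝 1) := by
    rw [← entireG_zero (q := q)]
    exact tendsto_entireG hq (tendsto_mul_pow hq a)
      ((tendsto_mul_pow hq b).comp (tendsto_sub_atTop_nat 1)) (tendsto_mul_pow hq l)
  have hβ : Tendsto (cf2 a b l q).num atTop (𝓝 0) := by
    have h1 := (tendsto_mul_pow hq l).comp (tendsto_add_atTop_nat 1)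
    have h2 := (tendsto_mul_pow hq (a * b)).comp
      ((tendsto_add_atTop_nat 1).const_mul_atTop' two_pos)
    simpa [cf2] using h1.sub h2
  rw [← hT0, ← hT1]
  exact (CFrac.converges_of_adjoint hc hT hτ one_ne_zero hβ (by simp)).1

lemma converges_cf3 (hq : ‖q‖ < 1) {a b l : ℂ} (hc : ∀ n, (cf3 a b l q).num n ≠ 0)
    (hb : ‖b‖ < 1) :
    (cf3 a b l q).ConvergesTo (ratio (entireG a b l q) (entireG (a * q) b (l * q) q)) ∧
      (cf3 a b l q).ConvergesSeparatelyTo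
        (ratio (entireG a b l q) (entireG (a * q) b (l * q) q)) := by
  set T : ℕ → ℂ := fun n => entireG (a * q ^ n) b (l * q ^ n) q with hTdef
  have hT0 : T 0 = entireG a b l q := by simp [T]
  have hT1 : T 1 = entireG (a * q) b (l * q) q := by simp [T]
  have hT : ∀ n, T n = (cf3 a b l q).den n * T (n + 1) + (cf3 a b l q).num n * T (n + 2) := by
    intro n
    have h := entireG_shift_al_al hq (a * q ^ n) b (l * q ^ n)
    simp only [T, cf3]
    ring_nf at h ⊢
    linear_combination h
  have hτ : Tendsto T atTop (𝓝 (eulerSum q b)) := by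
    rw [← entireG_zero_outer]
    exact tendsto_entireG hq (tendsto_mul_pow hq a) tendsto_const_nhds (tendsto_mul_pow hq l)
  have hβ : Tendsto (cf3 a b l q).num atTop (𝓝 b) := by
    have h1 := ((tendsto_mul_pow hq l).comp (tendsto_add_atTop_nat 1)).add_const b
    simpa [cf3] using h1
  rw [← hT0, ← hT1]
  exact (CFrac.converges_of_adjoint hc hT hτ (eulerSum_ne_zero_of_norm_lt_one hq hb) hβ hb).1

lemma converges_cf4 (hq : ‖q‖ < 1) {a b l : ℂ} (hc : ∀ n, (cf4 a b l q).num n ≠ 0)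
    (ha : ‖a * q‖ < 1) :
    (cf4 a b l q).ConvergesTo (ratio (entireG a b l q) (entireG (a * q) b (l * q) q)) ∧
      (cf4 a b l q).ConvergesSeparatelyTo
        (ratio (entireG a b l q) (entireG (a * q) b (l * q) q)) := by
  -- After the first step a stays at aq while b and λ shrink, so the limit is H(aq,0,0) = E(aq).
  set T : ℕ → ℂ := fun n => if n = 0 then entireG a b l q else
    entireG (a * q) (b * q ^ (n - 1)) (l * q ^ n) q with hTdef
  have hT0 : T 0 = entireG a b l q := by simp [T]
  have hT1 : T 1 = entireG (a * q) b (l * q) q := by simp [T]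
  have hT : ∀ n, T n = (cf4 a b l q).den n * T (n + 1) + (cf4 a b l q).num n * T (n + 2) := by
    intro n
    rcases n with _ | n
    · simpa [T, cf4] using entireG_shift_al hq a b l
    · have h := entireG_shift_bl_bl hq (a * q) (b * q ^ n) (l * q ^ (n + 1))
      simp [T, cf4]
      ring_nf at h ⊢
      linear_combination h
  have hτ : Tendsto T atTop (𝓝 (eulerSum q (a * q))) := by
    rw [← entireG_zero_right]
    refine (tendsto_entireG hq tendsto_const_nhds ((tendsto_mul_pow hq b).comp
      (tendsto_sub_atTop_nat 1)) (tendsto_mul_pow hq l)).congr' ?_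
    filter_upwards [eventually_ne_atTop 0] with n hn
    simp [T, hn]
  have hβ : Tendsto (cf4 a b l q).num atTop (𝓝 (a * q)) := by
    have h1 := ((tendsto_mul_pow hq l).comp (tendsto_add_atTop_nat 1)).const_add (a * q)
    simpa [cf4] using h1
  rw [← hT0, ← hT1]
  exact (CFrac.converges_of_adjoint hc hT hτ (eulerSum_ne_zero_of_norm_lt_one hq ha) hβ ha).1

/-! ### Return to the series G -/

/-- Splitting the first n factors off E(b) leaves E(bqⁿ), and those factors are exactly the b-part
of the denominator in G. -/
lemma entireGTerm_eq_mul_gTerm (hq : ‖q‖ < 1) (a l : ℂ) {b : ℂ}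
    (hb : ∀ n, 1 + b * q ^ (n + 1) ≠ 0) (n : ℕ) :
    entireGTerm a b l q n = eulerSum q b * gTerm a b l q n := by
  have h1 : ∏ k ∈ Finset.range n, (1 + b * q ^ (k + 1)) ≠ 0 :=
    Finset.prod_ne_zero_iff.2 fun k _ => hb k
  have h2 : ∏ k ∈ Finset.range n, (1 - q ^ (k + 1)) ≠ 0 :=
    Finset.prod_ne_zero_iff.2 fun k _ => one_sub_pow_ne_zero hq k
  rw [entireGTerm, gTerm, eulerSum_eq_prod_mul hq b n, Finset.prod_mul_distrib, eulerCoeff,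
    shiftedPow]
  field_simp

lemma summable_gTerm (hq : ‖q‖ < 1) (a l : ℂ) {b : ℂ} (hb : ∀ n, 1 + b * q ^ (n + 1) ≠ 0) :
    Summable (gTerm a b l q) := by
  have h := summable_entireGTerm hq a b l
  rw [funext (entireGTerm_eq_mul_gTerm hq a l hb)] at h
  exact (summable_mul_left_iff (eulerSum_ne_zero hq hb)).1 h

lemma entireG_eq_mul_G (hq : ‖q‖ < 1) (a l : ℂ) {b : ℂ} (hb : ∀ n, 1 + b * q ^ (n + 1) ≠ 0) :
    entireG a b l q = eulerSum q b * G a b l q := by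
  rw [entireG, G, ← tsum_mul_left]
  exact tsum_congr (entireGTerm_eq_mul_gTerm hq a l hb)

end RRCF

end

theorem mainTheorem1 (a b l q : ℂ) (hq0 : q ≠ 0) (hq1 : ‖q‖ < 1)
    (hne : ¬ (a = 0 ∧ b = 0 ∧ l = 0))
    (hl : ∀ n : ℕ, 1 ≤ n → l ≠ a * b * q ^ n ∧ l ≠ -b / q ^ n ∧ l ≠ -a / q ^ (n - 1)) :
    (∃ L : OnePoint ℂ,
      ((RRCF.cf1 a b l q).ConvergesTo L ∧ (RRCF.cf1 a b l q).ConvergesSeparatelyTo L) ∧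
      ((RRCF.cf2 a b l q).ConvergesTo L ∧ (RRCF.cf2 a b l q).ConvergesSeparatelyTo L) ∧
      (‖b‖ < 1 →
        (RRCF.cf3 a b l q).ConvergesTo L ∧ (RRCF.cf3 a b l q).ConvergesSeparatelyTo L) ∧
      (‖a * q‖ < 1 →
        (RRCF.cf4 a b l q).ConvergesTo L ∧ (RRCF.cf4 a b l q).ConvergesSeparatelyTo L) ∧
      ((∀ n : ℕ, 1 ≤ n → 1 + b * q ^ n ≠ 0) →
        Summable (RRCF.gTerm a b l q) ∧ Summable (RRCF.gTerm (a * q) b (l * q) q) ∧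
        (RRCF.G a b l q ≠ 0 ∨ RRCF.G (a * q) b (l * q) q ≠ 0) ∧
        L = RRCF.ratio (RRCF.G a b l q) (RRCF.G (a * q) b (l * q) q))) ∧
    RRCF.BauerMuirObtains (RRCF.cf1 a b l q) (RRCF.w12 a b q) (RRCF.cf2 a b l q) ∧
    RRCF.BauerMuirObtains (RRCF.cf2 a b l q) (RRCF.w23 b q) (RRCF.cf3 a b l q) ∧
    RRCF.BauerMuirObtains (RRCF.cf3 a b l q) (RRCF.w34 a b q) (RRCF.cf4 a b l q) ∧
    RRCF.BauerMuirObtains (RRCF.cf4 a b l q) (RRCF.w41 a b q) (RRCF.cf1 a b l q) := by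
  have hab : ∀ n : ℕ, l ≠ a * b * q ^ (n + 1) := fun n => (hl (n + 1) (by omega)).1
  have hb : ∀ n : ℕ, l * q ^ (n + 1) + b ≠ 0 := fun n h =>
    (hl (n + 1) (by omega)).2.1 ((eq_div_iff (pow_ne_zero _ hq0)).2 (by linear_combination h))
  have ha : ∀ n : ℕ, a + l * q ^ n ≠ 0 := fun n h =>
    (hl (n + 1) (by omega)).2.2 ((eq_div_iff (pow_ne_zero _ hq0)).2
      (by rw [Nat.add_sub_cancel]; linear_combination h))
  have hc1 : ∀ n, (RRCF.cf1 a b l q).num n ≠ 0 := by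
    intro n
    rcases n.even_or_odd' with ⟨m, rfl | rfl⟩
    · convert mul_ne_zero (pow_ne_zero (m + 1) hq0) (ha m) using 1
      simp [RRCF.cf1]
      ring
    · have e : (2 * m + 1) / 2 = m := by omega
      convert mul_ne_zero (pow_ne_zero (m + 1) hq0) (hb m) using 1
      simp [RRCF.cf1, e]
      ring
  have hc2 : ∀ n, (RRCF.cf2 a b l q).num n ≠ 0 := by
    intro n
    convert mul_ne_zero (pow_ne_zero (n + 1) hq0) (sub_ne_zero.2 (hab n)) using 1
    simp only [RRCF.cf2]
    ring
  have hc4 : ∀ n, (RRCF.cf4 a b l q).num n ≠ 0 := by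
    intro n
    convert mul_ne_zero hq0 (ha n) using 1
    simp only [RRCF.cf4]
    ring
  obtain ⟨h1, hG⟩ := RRCF.converges_cf1 hq1 hc1
  refine ⟨⟨_, h1, RRCF.converges_cf2 hq1 hc2, RRCF.converges_cf3 hq1 hb,
    RRCF.converges_cf4 hq1 hc4, fun hbn => ?_⟩, RRCF.bauerMuirObtains_cf1_cf2 hq0 hab,
    RRCF.bauerMuirObtains_cf2_cf3 hq0 hb, RRCF.bauerMuirObtains_cf3_cf4 hq0 ha,
    RRCF.bauerMuirObtains_cf4_cf1 hq0 ha fun n => by rw [add_comm]; exact hb n⟩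
  have hbn' : ∀ n : ℕ, 1 + b * q ^ (n + 1) ≠ 0 := fun n => hbn (n + 1) (by omega)
  have hE := RRCF.eulerSum_ne_zero hq1 hbn'
  -- Both values of H have the same b, so they carry the same non-zero factor E(b), which cancels in
  -- the ratio.
  rw [RRCF.entireG_eq_mul_G hq1 _ _ hbn', RRCF.entireG_eq_mul_G hq1 _ _ hbn'] at hG ⊢
  exact ⟨RRCF.summable_gTerm hq1 _ _ hbn', RRCF.summable_gTerm hq1 _ _ hbn',
    hG.imp right_ne_zero_of_mul right_ne_zero_of_mul, RRCF.ratio_mul_left hE⟩
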